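/- Let $X=Y=[0,1]$, each equipped with Lebesgue measure ($m$ on $X$, $\nu$ on $Y$), and let $(Z,\mu)=(X\times Y,\,m\times\nu)$. For a measure space $\Omega$ let $\mathcal{G}(\Omega)$ be the group of invertible measure-preserving transformations of $\Omega$, where transformations are identified when they agree almost everywhere. For $T_0\in\mathcal{G}(X)$ let $\mathcal{G}_{T_0}\subset\mathcal{G}(Z)$ be the set of all extensions of $T_0$ through the projection $Z\to X$, that is, all $T\in\mathcal{G}(Z)$ such that the first coordinate of $T(x,y)$ equals $T_0x$ for almost every $(x,y)\in Z$. Equip $\mathcal{G}(Z)$ with the weak topology, for which the sets $\{S\in\mathcal{G}(Z) : \mu(TA\,\triangle\,SA)<\varepsilon\}$ with $T\in\mathcal{G}(Z)$, $A\subset Z$ measurable and $\varepsilon>0$ form a subbase, and equip $\mathcal{G}_{T_0}$ with the subspace topology. Write $\mathrm{id}_X$ for the identity transformation of $X$. **Theorem.** Let $T_0\in\mathcal{G}(X)$ be antiperiodic, that is, the set of periodic points of $T_0$ has measure zero, and let $\hat T\in\mathcal{G}_{T_0}$. Then the set $$\{S^{-1}\hat T S : S\in\mathcal{G}_{\mathrm{id}_X}\}$$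 is contained in $\mathcal{G}_{T_0}$ and is dense in $\mathcal{G}_{T_0}$. -/

import Mathlib

open MeasureTheory Filter Function
open scoped unitInterval symmDiff ENNReal

namespace ErgodicExt

variable {α β : Type*} [MeasurableSpace α] [MeasurableSpace β]

/-- A representative of an invertible measure-preserving transformation of `(α, μ)`: a
measure-preserving map together with a measure-preserving map which inverts it almost
everywhere on both sides. -/
structure PreAut (μ : Measure α) where
  toFun : α → α
  invFun : α → α
  mp : MeasurePreserving toFun μ μ
  mp_inv : MeasurePreserving invFun μ μ
  left_inv : ∀ᵐ x ∂μ, invFun (toFun x) = x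
  right_inv : ∀ᵐ x ∂μ, toFun (invFun x) = x

namespace PreAut

variable {μ : Measure α}

/-- Two transformations are identified when they agree almost everywhere. -/
instance setoid (μ : Measure α) : Setoid (PreAut μ) where
  r S T := ∀ᵐ x ∂μ, S.toFun x = T.toFun x
  iseqv :=
    { refl := fun S => Eventually.of_forall fun x => rfl
      symm := fun h => h.mono fun x hx => hx.symm
      trans := fun h₁ h₂ => by filter_upwards [h₁, h₂] with x a b using a.trans b }

theorem equiv_iff {S T : PreAut μ} : S ≈ T ↔ ∀ᵐ x ∂μ, S.toFun x = T.toFun x := Iff.rfl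

theorem ae_comp (S : PreAut μ) {p : α → Prop} (h : ∀ᵐ x ∂μ, p x) :
    ∀ᵐ x ∂μ, p (S.toFun x) :=
  S.mp.quasiMeasurePreserving.ae h

theorem ae_comp_inv (S : PreAut μ) {p : α → Prop} (h : ∀ᵐ x ∂μ, p x) :
    ∀ᵐ x ∂μ, p (S.invFun x) :=
  S.mp_inv.quasiMeasurePreserving.ae h

theorem inv_congr {S T : PreAut μ} (h : S ≈ T) : ∀ᵐ x ∂μ, S.invFun x = T.invFun x := by
  filter_upwards [S.right_inv, S.ae_comp_inv T.left_inv, S.ae_comp_inv (equiv_iff.1 h)]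
    with x h₁ h₂ h₃
  rw [← h₂, ← h₃, h₁]

/-- The identity transformation. -/
def one (μ : Measure α) : PreAut μ where
  toFun := id
  invFun := id
  mp := MeasurePreserving.id μ
  mp_inv := MeasurePreserving.id μ
  left_inv := Eventually.of_forall fun _ => rfl
  right_inv := Eventually.of_forall fun _ => rfl

/-- Composition: first `T`, then `S`. -/
def mul (S T : PreAut μ) : PreAut μ where
  toFun := S.toFun ∘ T.toFun
  invFun := T.invFun ∘ S.invFun
  mp := S.mp.comp T.mp
  mp_inv := T.mp_inv.comp S.mp_inv
  left_inv := by
    filter_upwards [T.left_inv, T.ae_comp S.left_inv] with x h₁ h₂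
    simp only [comp_apply, h₂, h₁]
  right_inv := by
    filter_upwards [S.right_inv, S.ae_comp_inv T.right_inv] with x h₁ h₂
    simp only [comp_apply, h₂, h₁]

/-- The inverse transformation. -/
def inv (S : PreAut μ) : PreAut μ where
  toFun := S.invFun
  invFun := S.toFun
  mp := S.mp_inv
  mp_inv := S.mp
  left_inv := S.right_inv
  right_inv := S.left_inv

theorem iterate_congr {S T : PreAut μ} (h : S ≈ T) (n : ℕ) :
    ∀ᵐ x ∂μ, S.toFun^[n] x = T.toFun^[n] x := by
  induction n with
  | zero => exact Eventually.of_forall fun _ => rfl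
  | succ n ih =>
    filter_upwards [equiv_iff.1 h, T.ae_comp ih] with x h₁ h₂
    rw [iterate_succ_apply, iterate_succ_apply, h₁, h₂]

end PreAut

/-- The set `𝒢(α, μ)` of invertible measure-preserving transformations of `(α, μ)`, taken
modulo almost everywhere equality. -/
def Aut (μ : Measure α) : Type _ := Quotient (PreAut.setoid μ)

namespace Aut

variable {μ : Measure α}

instance : Group (Aut μ) where
  mul := Quotient.map₂ PreAut.mul fun S S' hS T T' hT => by
    filter_upwards [PreAut.equiv_iff.1 hT, T.ae_comp (PreAut.equiv_iff.1 hS)] with x h₁ h₂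
    change S.toFun (T.toFun x) = S'.toFun (T'.toFun x)
    rw [h₂, h₁]
  one := Quotient.mk _ (PreAut.one μ)
  inv := Quotient.map PreAut.inv fun _ _ h => PreAut.inv_congr h
  mul_assoc := by
    rintro ⟨R⟩ ⟨S⟩ ⟨T⟩
    exact Quotient.sound (Eventually.of_forall fun _ => rfl)
  one_mul := by
    rintro ⟨T⟩
    exact Quotient.sound (Eventually.of_forall fun _ => rfl)
  mul_one := by
    rintro ⟨T⟩
    exact Quotient.sound (Eventually.of_forall fun _ => rfl)
  inv_mul_cancel := by
    rintro ⟨T⟩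
    exact Quotient.sound T.left_inv

/-- `imageDist T S A = μ (T A ∆ S A)`. The image `T A` is written, up to a null set, as the
preimage of `A` under the inverse of `T`. -/
def imageDist (T S : Aut μ) (A : Set α) : ℝ≥0∞ :=
  Quotient.liftOn₂ T S (fun T S => μ ((T.invFun ⁻¹' A) ∆ (S.invFun ⁻¹' A)))
    fun T S T' S' hT hS => by
      refine measure_congr ?_
      have hT' : (T.invFun ⁻¹' A : Set α) =ᵐ[μ] (T'.invFun ⁻¹' A : Set α) := by
        filter_upwards [PreAut.inv_congr hT] with x hx
        exact congrArg (· ∈ A) hx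
      have hS' : (S.invFun ⁻¹' A : Set α) =ᵐ[μ] (S'.invFun ⁻¹' A : Set α) := by
        filter_upwards [PreAut.inv_congr hS] with x hx
        exact congrArg (· ∈ A) hx
      exact hT'.symmDiff hS'

/-- The weak topology, with the sets `{S | μ (T A ∆ S A) < ε}` as a subbase, for `T` a
transformation, `A` a measurable set and `ε > 0`. -/
instance : TopologicalSpace (Aut μ) :=
  TopologicalSpace.generateFrom
    {U | ∃ (T : Aut μ) (A : Set α) (ε : ℝ≥0∞), MeasurableSet A ∧ 0 < ε ∧
      U = {S | imageDist T S A < ε}}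

/-- `T` is antiperiodic: the set of its periodic points is null. -/
def Antiperiodic (T : Aut μ) : Prop :=
  Quotient.liftOn T (fun T => μ (periodicPts T.toFun) = 0) fun S T h => by
    have key : (periodicPts S.toFun : Set α) =ᵐ[μ] (periodicPts T.toFun : Set α) := by
      filter_upwards [ae_all_iff.2 (PreAut.iterate_congr h)] with x hx
      refine propext ?_
      change x ∈ periodicPts S.toFun ↔ x ∈ periodicPts T.toFun
      simp only [mem_periodicPts, IsPeriodicPt, IsFixedPt, hx]
    simp only [measure_congr key]

/-- `T` is an extension of `T₀` through the first projection: for almost every `(x, y)`, the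
first coordinate of `T (x, y)` is `T₀ x`. -/
def IsExtension {ν : Measure β} [SFinite ν] (T : Aut (μ.prod ν)) (T₀ : Aut μ) : Prop :=
  Quotient.liftOn₂ T T₀ (fun T T₀ => ∀ᵐ z ∂(μ.prod ν), (T.toFun z).1 = T₀.toFun z.1)
    fun T T₀ T' T₀' hT hT₀ => by
      refine propext (eventually_congr ?_)
      filter_upwards [PreAut.equiv_iff.1 hT,
        Measure.quasiMeasurePreserving_fst.ae (PreAut.equiv_iff.1 hT₀)] with z h₁ h₂
      rw [h₁, h₂]

end Aut

/-- `𝒢_{T₀}`: the transformations of the unit square that extend the transformation `T₀` of the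
unit interval. All measures are Lebesgue measures. -/
def extensions (T₀ : Aut (volume : Measure I)) :
    Set (Aut ((volume : Measure I).prod (volume : Measure I))) :=
  {T | T.IsExtension T₀}

end ErgodicExt

namespace ErgodicExt

open Topology

/-! Let `R` and `T` extend `T₀`. Solving `S * T = R * S` fibre by fibre along an orbit of `T₀` is a
recursion: once `S` is the identity over a starting point, it must be `R ^ n * T ^ (-n)` over the
point `n` steps later. Restarting whenever the orbit enters a set `B` meeting all backward orbits
defines `S` everywhere, and `S⁻¹ * R * S = T` fails only over `T₀ ⁻¹ B`. Antiperiodicity supplies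
such a `B` of arbitrarily small measure (`exists_measure_lt_forall_exists_iterate_mem`), so no
Rokhlin tower is needed. The resulting error bound `μ B` is uniform in `A`, which is more than weak
density requires. -/

/-! ### Small sets meeting every forward orbit -/

/-- A measure-preserving self-map of the unit interval almost all of whose points are aperiodic
admits measurable sets of arbitrarily small measure which meet every forward orbit. -/
theorem exists_measure_lt_forall_exists_iterate_mem {g : I → I}
    (hg : MeasurePreserving g (volume : Measure I) volume)
    (hper : (volume : Measure I) (periodicPts g) = 0) {ε : ℝ≥0∞} (hε : 0 < ε) :
    ∃ B : Set I, MeasurableSet B ∧ volume B < ε ∧ ∀ x, ∃ i : ℕ, g^[i] x ∈ B := by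
  -- Points within `1 / (n + 1)` of the infimum of their forward orbit; every orbit contains one.
  let B : ℕ → Set I := fun n => {x | ∀ i : ℕ, (x : ℝ) ≤ g^[i] x + 1 / ((n : ℝ) + 1)}
  have hBm : ∀ n, MeasurableSet (B n) := fun n => by
    have : B n = ⋂ i : ℕ, {x : I | (x : ℝ) ≤ g^[i] x + 1 / ((n : ℝ) + 1)} := by
      ext x; simp [B]
    rw [this]
    exact MeasurableSet.iInter fun i => measurableSet_le measurable_subtype_coe
      ((measurable_subtype_coe.comp (hg.measurable.iterate i)).add_const _)
  have hanti : Antitone B := fun m n hmn x hx i =>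
    (hx i).trans (by gcongr)
  have hnull : volume (⋂ n, B n) = 0 := by
    rw [measure_eq_zero_iff_ae_notMem]
    have hret := hg.conservative.ae_mem_imp_frequently_image_mem
      (MeasurableSet.iInter hBm).nullMeasurableSet
    filter_upwards [hret, hg.conservative.ae_frequently_mem_of_mem_nhds,
      measure_eq_zero_iff_ae_notMem.1 hper] with x hx hrec hap hxB
    have hmin : ∀ y ∈ ⋂ n, B n, ∀ i, y ≤ g^[i] y := fun y hy i => by
      have hlim : Tendsto (fun n : ℕ => ((g^[i] y : I) : ℝ) + 1 / ((n : ℝ) + 1)) atTop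
          (𝓝 (((g^[i] y : I) : ℝ) + 0)) :=
        tendsto_const_nhds.add tendsto_one_div_add_atTop_nhds_zero_nat
      have := ge_of_tendsto' hlim fun n => Set.mem_iInter.1 hy n i
      rw [add_zero] at this
      exact this
    -- A point of the intersection is the minimum of its forward orbit. If `x` returns there at time
    -- `j`, then `x < g^[j] x`, and a later return close to `x` drops below `g^[j] x`, against the
    -- minimality of `g^[j] x`.
    obtain ⟨j, hjB, hj⟩ := ((hx hxB).and_eventually (eventually_gt_atTop 0)).exists
    have hlt : x < g^[j] x := lt_of_le_of_ne (hmin x hxB j) fun h =>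
      hap (mk_mem_periodicPts hj h.symm)
    obtain ⟨k, hk, hjk⟩ := ((hrec _ (Iio_mem_nhds hlt)).and_eventually
      (eventually_ge_atTop j)).exists
    have := hmin _ hjB (k - j)
    rw [← iterate_add_apply, Nat.sub_add_cancel hjk] at this
    exact absurd hk (not_lt.2 this)
  have hlim := tendsto_measure_iInter_atTop (μ := (volume : Measure I))
    (fun n => (hBm n).nullMeasurableSet) hanti ⟨0, measure_ne_top _ _⟩
  rw [hnull] at hlim
  obtain ⟨n, hn⟩ := (hlim.eventually (gt_mem_nhds hε)).exists
  refine ⟨B n, hBm n, hn, fun x => ?_⟩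
  have hbdd : BddBelow (Set.range fun i : ℕ => ((g^[i] x : I) : ℝ)) :=
    ⟨0, by rintro _ ⟨i, rfl⟩; exact (g^[i] x).2.1⟩
  have hpos : (0 : ℝ) < 1 / ((n : ℝ) + 1) := Nat.one_div_pos_of_nat
  obtain ⟨i, hi⟩ := exists_lt_of_ciInf_lt (lt_add_of_pos_right
    (⨅ i : ℕ, ((g^[i] x : I) : ℝ)) hpos)
  refine ⟨i, fun k => hi.le.trans ?_⟩
  rw [← iterate_add_apply]
  gcongr
  exact ciInf_le hbdd (k + i)

section

variable {α β : Type*} [MeasurableSpace α] [MeasurableSpace β] {μ : Measure α} {ν : Measure β}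

/-! ### Fibrewise gluing and conjugation off a small set -/

namespace PreAut

theorem ae_iterate_iterate_invFun (T : PreAut μ) (n : ℕ) :
    ∀ᵐ x ∂μ, T.toFun^[n] (T.invFun^[n] x) = x := by
  induction n with
  | zero => exact Eventually.of_forall fun _ => rfl
  | succ n ih =>
    filter_upwards [T.right_inv, T.ae_comp_inv ih] with x h₁ h₂
    rw [iterate_succ_apply T.invFun, iterate_succ_apply', h₂, h₁]

theorem measure_periodicPts_invFun (T : PreAut μ) (h : μ (periodicPts T.toFun) = 0) :
    μ (periodicPts T.invFun) = 0 := by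
  rw [measure_eq_zero_iff_ae_notMem] at h ⊢
  filter_upwards [h, ae_all_iff.2 T.ae_iterate_iterate_invFun] with x hx hT hper
  obtain ⟨n, hn, hp⟩ := hper
  refine hx ⟨n, hn, ?_⟩
  have := hT n
  rwa [hp.eq] at this

/-- `T` maps almost every fibre of the first projection to the fibre prescribed by `T₀`. -/
def Extends (T : PreAut (μ.prod ν)) (T₀ : PreAut μ) : Prop :=
  ∀ᵐ z ∂(μ.prod ν), (T.toFun z).1 = T₀.toFun z.1

theorem ae_fst {p : α → Prop} (h : ∀ᵐ x ∂μ, p x) : ∀ᵐ z ∂(μ.prod ν), p z.1 :=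
  Measure.quasiMeasurePreserving_fst.ae h

theorem Extends.mul {S T : PreAut (μ.prod ν)} {S₀ T₀ : PreAut μ} (hS : S.Extends S₀)
    (hT : T.Extends T₀) : (S.mul T).Extends (S₀.mul T₀) := by
  filter_upwards [hT, T.ae_comp hS] with z h₁ h₂
  change (S.toFun (T.toFun z)).1 = S₀.toFun (T₀.toFun z.1)
  rw [h₂, h₁]

theorem Extends.inv {T : PreAut (μ.prod ν)} {T₀ : PreAut μ} (hT : T.Extends T₀) :
    T.inv.Extends T₀.inv := by
  filter_upwards [T.right_inv, T.ae_comp_inv hT, T.ae_comp_inv (ae_fst T₀.left_inv)]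
    with z h₁ h₂ h₃
  change (T.invFun z).1 = T₀.invFun z.1
  rw [h₁] at h₂
  rw [h₂, h₃]

theorem Extends.congr {T : PreAut (μ.prod ν)} {S₀ T₀ : PreAut μ} (hT : T.Extends S₀)
    (h : ∀ᵐ x ∂μ, S₀.toFun x = T₀.toFun x) : T.Extends T₀ := by
  filter_upwards [hT, ae_fst h] with z h₁ h₂
  rw [h₁, h₂]

/-- Each `f n` fixes the base coordinate almost everywhere, so it respects the partition into the
countably many sets `k z.1 = n`, and measures add up over the pieces. -/
theorem measurePreserving_glue {f : ℕ → α × β → α × β}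
    (hf : ∀ n, MeasurePreserving (f n) (μ.prod ν) (μ.prod ν))
    (hfst : ∀ n, ∀ᵐ z ∂(μ.prod ν), (f n z).1 = z.1) {k : α → ℕ} (hk : Measurable k) :
    MeasurePreserving (fun z => f (k z.1) z) (μ.prod ν) (μ.prod ν) := by
  have hF : Measurable fun z => f (k z.1) z := by
    have : Measurable fun p : ℕ × (α × β) => f p.1 p.2 :=
      measurable_from_prod_countable_right fun n => (hf n).measurable
    exact this.comp ((hk.comp measurable_fst).prodMk measurable_id)
  have hK : ∀ n, MeasurableSet {z : α × β | k z.1 = n} := fun n =>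
    (hk.comp measurable_fst) (measurableSet_singleton n)
  have hsum : ∀ A, MeasurableSet A →
      (μ.prod ν) A = ∑' n, (μ.prod ν) ({z | k z.1 = n} ∩ A) := fun A hA => by
    rw [← measure_iUnion (fun m n hmn => Set.disjoint_left.2 fun z hm hn =>
      hmn (hm.1.symm.trans hn.1)) fun n => (hK n).inter hA]
    congr 1
    ext z
    simp
  refine ⟨hF, Measure.ext fun A hA => ?_⟩
  rw [Measure.map_apply hF hA, hsum _ (hF hA), hsum A hA]
  refine tsum_congr fun n => ?_
  rw [← (hf n).measure_preimage ((hK n).inter hA).nullMeasurableSet]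
  refine measure_congr ?_
  filter_upwards [hfst n] with z hz
  refine propext ⟨fun h => ?_, fun h => ?_⟩
  · obtain ⟨h₁ : k z.1 = n, h₂ : f (k z.1) z ∈ A⟩ := h
    rw [h₁] at h₂
    exact ⟨show k (f n z).1 = n by rw [hz, h₁], h₂⟩
  · obtain ⟨h₁ : k (f n z).1 = n, h₂ : f n z ∈ A⟩ := h
    rw [hz] at h₁
    exact ⟨h₁, show f (k z.1) z ∈ A by rwa [h₁]⟩

/-- The transformation which agrees with `Q n` on the fibres over `{x | k x = n}`, for a
sequence `Q` of transformations mapping almost every fibre to itself. -/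
def glue (Q : ℕ → PreAut (μ.prod ν)) (hQ : ∀ n, (Q n).Extends (one μ)) (k : α → ℕ)
    (hk : Measurable k) : PreAut (μ.prod ν) where
  toFun z := (Q (k z.1)).toFun z
  invFun z := (Q (k z.1)).invFun z
  mp := measurePreserving_glue (fun n => (Q n).mp) hQ hk
  mp_inv := measurePreserving_glue (fun n => (Q n).mp_inv) (fun n => (hQ n).inv) hk
  left_inv := by
    filter_upwards [ae_all_iff.2 fun n => (Q n).left_inv, ae_all_iff.2 hQ] with z h₁ h₂
    have h₃ : ((Q (k z.1)).toFun z).1 = z.1 := h₂ _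
    rw [h₃, h₁]
  right_inv := by
    filter_upwards [ae_all_iff.2 fun n => (Q n).right_inv,
      ae_all_iff.2 fun n => (hQ n).inv] with z h₁ h₂
    have h₃ : ((Q (k z.1)).invFun z).1 = z.1 := h₂ _
    rw [h₃, h₁]

theorem extends_glue (Q : ℕ → PreAut (μ.prod ν)) (hQ : ∀ n, (Q n).Extends (one μ)) (k : α → ℕ)
    (hk : Measurable k) : (glue Q hQ k hk).Extends (one μ) := by
  filter_upwards [ae_all_iff.2 hQ] with z h using h _

/-- The transformations `R ^ n * T ^ (-n)`. -/
def powMulInvPow (R T : PreAut μ) : ℕ → PreAut μ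
  | 0 => one μ
  | n + 1 => (R.mul (powMulInvPow R T n)).mul T.inv

theorem extends_powMulInvPow {R T : PreAut (μ.prod ν)} {T₀ : PreAut μ} (hR : R.Extends T₀)
    (hT : T.Extends T₀) (n : ℕ) : (powMulInvPow R T n).Extends (one μ) := by
  induction n with
  | zero => exact Eventually.of_forall fun _ => rfl
  | succ n ih => exact ((hR.mul ih).mul hT.inv).congr T₀.right_inv

/-- Two extensions `R` and `T` of the same transformation `T₀` are conjugate by a transformation
preserving almost every fibre, up to the fibres over the preimage under `T₀` of any given
measurable set meeting all backward orbits. -/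
theorem exists_extends_one_ae_conj {R T : PreAut (μ.prod ν)} {T₀ : PreAut μ} (hR : R.Extends T₀)
    (hT : T.Extends T₀) {B : Set α} (hB : MeasurableSet B)
    (hsweep : ∀ x, ∃ i : ℕ, T₀.invFun^[i] x ∈ B) :
    ∃ S : PreAut (μ.prod ν), S.Extends (one μ) ∧
      ∀ᵐ z ∂(μ.prod ν), T₀.toFun z.1 ∉ B → S.invFun (R.toFun (S.toFun z)) = T.toFun z := by
  classical
  -- Time since the last visit to `B`, equal to `0` on `B` itself, where `S` restarts as the
  -- identity.
  let k : α → ℕ := fun x => Nat.find (hsweep x)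
  have hk : Measurable k := measurable_find hsweep fun i => (T₀.mp_inv.measurable.iterate i) hB
  have hstep : ∀ x, x ∉ B → k x = k (T₀.invFun x) + 1 := fun x hx =>
    Nat.find_comp_succ (hsweep x) (hsweep (T₀.invFun x)) hx
  let S := glue (powMulInvPow R T) (extends_powMulInvPow hR hT) k hk
  refine ⟨S, extends_glue _ _ _ _, ?_⟩
  filter_upwards [T.left_inv, hT, ae_fst T₀.left_inv, T.ae_comp S.left_inv] with z h₁ h₂ h₃ h₄ hz
  have hkz : k (T.toFun z).1 = k z.1 + 1 := by rw [h₂, hstep _ hz, h₃]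
  -- With `n = k z.1` this is `R ^ (n + 1) * T ^ (-(n + 1)) * T = R * (R ^ n * T ^ (-n))`.
  have key : S.toFun (T.toFun z) = R.toFun (S.toFun z) := by
    change (powMulInvPow R T (k (T.toFun z).1)).toFun (T.toFun z) =
      R.toFun ((powMulInvPow R T (k z.1)).toFun z)
    rw [hkz]
    change R.toFun ((powMulInvPow R T (k z.1)).toFun (T.invFun (T.toFun z))) = _
    rw [h₁]
  rw [← key, h₄]

/-- The images of `A` can differ only inside the image of `N` under `T`, which has the measure of
`N`. -/
theorem measure_preimage_invFun_symmDiff_le {S T : PreAut μ} {N : Set α} (hN : MeasurableSet N)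
    (h : ∀ᵐ x ∂μ, x ∉ N → S.toFun x = T.toFun x) (A : Set α) :
    μ ((T.invFun ⁻¹' A) ∆ (S.invFun ⁻¹' A)) ≤ μ N := by
  rw [← T.mp_inv.measure_preimage hN.nullMeasurableSet]
  refine measure_mono_ae ?_
  filter_upwards [T.right_inv, T.ae_comp_inv h, T.ae_comp_inv S.left_inv] with x h₁ h₂ h₃ hx
  by_contra hxN
  rw [h₂ hxN, h₁] at h₃
  rcases hx with ⟨h₄, h₅⟩ | ⟨h₄, h₅⟩
  · exact h₅ (show S.invFun x ∈ A from h₃ ▸ h₄)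
  · exact h₅ (show T.invFun x ∈ A from h₃ ▸ h₄)

end PreAut

/-! ### The weak topology and the group of extensions -/

namespace Aut

theorem imageDist_triangle (R S T : Aut μ) (A : Set α) :
    imageDist R T A ≤ imageDist R S A + imageDist S T A := by
  induction R using Quotient.inductionOn with | _ R
  induction S using Quotient.inductionOn with | _ S
  induction T using Quotient.inductionOn with | _ T
  exact measure_symmDiff_le _ _ _

/-- A neighbourhood of `T` in the weak topology contains all transformations which are uniformly
close to `T`. -/
theorem exists_forall_imageDist_le_imp_mem {U : Set (Aut μ)} (hU : IsOpen U) {T : Aut μ}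
    (hT : T ∈ U) : ∃ ε : ℝ≥0∞, 0 < ε ∧
      ∀ R : Aut μ, (∀ A, MeasurableSet A → imageDist T R A ≤ ε) → R ∈ U := by
  induction hU with
  | basic U hU =>
    obtain ⟨S, A, ε, hA, -, rfl⟩ := hU
    -- `δ` is slack in the strict inequality, to be spent in the triangle inequality.
    obtain ⟨δ, hδ, hlt⟩ := ENNReal.lt_iff_exists_add_pos_lt.1 (show imageDist S T A < ε from hT)
    exact ⟨δ, by exact_mod_cast hδ, fun R hR =>
      ((imageDist_triangle S T R A).trans (by gcongr; exact hR A hA)).trans_lt hlt⟩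
  | univ => exact ⟨1, one_pos, fun _ _ => trivial⟩
  | inter U V _ _ ihU ihV =>
    obtain ⟨ε, hε, h⟩ := ihU hT.1
    obtain ⟨δ, hδ, h'⟩ := ihV hT.2
    exact ⟨min ε δ, lt_min hε hδ, fun R hR =>
      ⟨h R fun A hA => (hR A hA).trans (min_le_left _ _),
        h' R fun A hA => (hR A hA).trans (min_le_right _ _)⟩⟩
  | sUnion 𝒰 _ ih =>
    obtain ⟨U, hU, hTU⟩ := hT
    obtain ⟨ε, hε, h⟩ := ih U hU hTU
    exact ⟨ε, hε, fun R hR => ⟨U, hU, h R hR⟩⟩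

variable [SFinite ν]

theorem IsExtension.mul {S T : Aut (μ.prod ν)} {S₀ T₀ : Aut μ} (hS : S.IsExtension S₀)
    (hT : T.IsExtension T₀) : (S * T).IsExtension (S₀ * T₀) := by
  induction S using Quotient.inductionOn with | _ S
  induction T using Quotient.inductionOn with | _ T
  induction S₀ using Quotient.inductionOn with | _ S₀
  induction T₀ using Quotient.inductionOn with | _ T₀
  exact PreAut.Extends.mul (S := S) (T := T) (S₀ := S₀) (T₀ := T₀) hS hT

theorem IsExtension.inv {T : Aut (μ.prod ν)} {T₀ : Aut μ} (hT : T.IsExtension T₀) :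
    T⁻¹.IsExtension T₀⁻¹ := by
  induction T using Quotient.inductionOn with | _ T
  induction T₀ using Quotient.inductionOn with | _ T₀
  exact PreAut.Extends.inv (T := T) (T₀ := T₀) hT

theorem IsExtension.conj {S T : Aut (μ.prod ν)} {T₀ : Aut μ} (hS : S.IsExtension 1)
    (hT : T.IsExtension T₀) : (S⁻¹ * T * S).IsExtension T₀ := by
  simpa using (hS.inv.mul hT).mul hS

end Aut

end

/-- Conjugates of an extension of an antiperiodic transformation by fibre-preserving
transformations are uniformly dense among all extensions. -/
theorem Aut.exists_conj_imageDist_le {T₀ : Aut (volume : Measure I)} (hT₀ : T₀.Antiperiodic)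
    {R T : Aut ((volume : Measure I).prod (volume : Measure I))} (hR : R ∈ extensions T₀)
    (hT : T ∈ extensions T₀) {ε : ℝ≥0∞} (hε : 0 < ε) :
    ∃ S ∈ extensions 1, ∀ A, imageDist T (S⁻¹ * R * S) A ≤ ε := by
  induction R using Quotient.inductionOn with | _ R
  induction T using Quotient.inductionOn with | _ T
  induction T₀ using Quotient.inductionOn with | _ T₀
  -- Forward orbits of the inverse of `T₀` are the backward orbits that `B` has to meet.
  obtain ⟨B, hB, hBε, hsweep⟩ := exists_measure_lt_forall_exists_iterate_mem T₀.mp_inv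
    (T₀.measure_periodicPts_invFun hT₀) hε
  obtain ⟨S, hS, hconj⟩ := PreAut.exists_extends_one_ae_conj (R := R) (T := T) (T₀ := T₀)
    hR hT hB hsweep
  have hmp := T₀.mp.comp
    (measurePreserving_fst (μ := (volume : Measure I)) (ν := (volume : Measure I)))
  refine ⟨Quotient.mk _ S, hS, fun A => ?_⟩
  refine (PreAut.measure_preimage_invFun_symmDiff_le (S := (S.inv.mul R).mul S) (T := T)
    (hmp.measurable hB) hconj A).trans ?_
  rw [hmp.measure_preimage hB.nullMeasurableSet]
  exact hBε.le

end ErgodicExt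

theorem mainTheorem4 (T₀ : ErgodicExt.Aut (volume : Measure I)) (hT₀ : T₀.Antiperiodic)
    (That : ErgodicExt.Aut ((volume : Measure I).prod (volume : Measure I)))
    (hThat : That ∈ ErgodicExt.extensions T₀) :
    {R | ∃ S ∈ ErgodicExt.extensions 1, R = S⁻¹ * That * S} ⊆ ErgodicExt.extensions T₀ ∧
      Dense {R : ErgodicExt.extensions T₀ |
        ∃ S ∈ ErgodicExt.extensions 1, R.1 = S⁻¹ * That * S} := by
  refine ⟨?_, dense_iff_inter_open.2 ?_⟩
  · rintro _ ⟨S, hS, rfl⟩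
    exact ErgodicExt.Aut.IsExtension.conj hS hThat
  · rintro _ ⟨U, hU, rfl⟩ ⟨T, hTU⟩
    obtain ⟨ε, hε, h⟩ := ErgodicExt.Aut.exists_forall_imageDist_le_imp_mem hU hTU
    obtain ⟨S, hS, hSε⟩ := ErgodicExt.Aut.exists_conj_imageDist_le hT₀ hThat T.2 hε
    exact ⟨⟨S⁻¹ * That * S, ErgodicExt.Aut.IsExtension.conj hS hThat⟩,
      h _ fun A _ => hSε A, S, hS, rfl⟩
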